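/- Let $u:[0,\infty)\times(-\infty,0]\to\mathbb{C}$ be a continuous function which solves the Klein-Gordon equation $\partial_x\partial_y u+u=0$ in the sense of distributions in the open quarter-plane $(0,\infty)\times(-\infty,0)$. Suppose that $u(0,y)=0$ for all $y\le 0$. Let $\theta_1,\theta_2>0$ be real numbers and let $\mathcal{Y}\subset(-\infty,0]$ be a set with $0\in\mathcal{Y}$ and $\inf\mathcal{Y}=-\infty$, and suppose that there is a constant $C$ such that $$|u(x,y)|\le C\exp\big(\theta_1x+\theta_2|y|\big)\qquad\text{for all }x\ge 0\text{ and }y\in\mathcal{Y}.$$ If $\theta_1\theta_2<1$, then $u(x,y)=0$ for all $x\ge0$ and $y\le 0$. -/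

import Mathlib

open Set Filter Asymptotics

namespace KleinGordon

open MeasureTheory TopologicalSpace
open scoped Distributions LineDeriv

/-- The complex-valued distribution `φ ↦ ∫ φ u` on the open set `Ω ⊆ ℝ²` defined by a function `u`
that is locally integrable on `Ω` for Lebesgue measure (the zero distribution for other `u`). -/
noncomputable def toDistribution (Ω : Opens (ℝ × ℝ)) (u : ℝ × ℝ → ℂ) : 𝓓'(Ω, ℂ) :=
  (TestFunction.integralAgainstBilinCLM (ContinuousLinearMap.lsmul ℝ ℝ) volume u :
    𝓓(Ω, ℝ) →L[ℝ] ℂ)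

theorem toDistribution_apply {Ω : Opens (ℝ × ℝ)} {u : ℝ × ℝ → ℂ}
    (hu : LocallyIntegrableOn u Ω) (φ : 𝓓(Ω, ℝ)) :
    toDistribution Ω u φ = ∫ p, φ p • u p :=
  TestFunction.integralAgainstBilinCLM_eq_integral hu

/-- `u` is locally integrable on `Ω` and solves the Klein-Gordon equation `∂ₓ∂ᵧu + u = 0`
in the sense of distributions on `Ω`. -/
def IsDistributionalSolution (Ω : Opens (ℝ × ℝ)) (u : ℝ × ℝ → ℂ) : Prop :=
  LocallyIntegrableOn u Ω ∧
    ∂_{((1, 0) : ℝ × ℝ)} (∂_{((0, 1) : ℝ × ℝ)} (toDistribution Ω u)) + toDistribution Ω u = 0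

/-- The closed spacelike quarter-plane `{(x, y) | 0 ≤ x, y ≤ 0}`. -/
def closedQuarterPlane : Set (ℝ × ℝ) := Ici 0 ×ˢ Iic 0

/-- The open spacelike quarter-plane `{(x, y) | 0 < x, y < 0}`. -/
def openQuarterPlane : Opens (ℝ × ℝ) := ⟨Ioi 0 ×ˢ Iio 0, isOpen_Ioi.prod isOpen_Iio⟩

end KleinGordon

/-!
Du Bois-Reymond's lemma, applied in each variable, turns the distributional equation into
`u(x, z) = u(x, y) - ∫_y^z ∫_0^x u`, a Volterra equation that spreads exponential growth in
`x` from one horizontal line to all of them. The Laplace transform `h(y) = ∫_0^∞ e^{-sx} u(x, y) dx`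
then satisfies `h' = -h / s`, so that `h(y) = e^{(y' - y) / s} h(y')`. If `θ₁ < re s` and
`θ₂ < re (1 / s)`, which is possible precisely because `θ₁θ₂ < 1`, letting `y' → -∞` through the set
where `u` has growth `e^{θ₂|y'|}` forces `h(y) = 0`, and `u = 0` because the Laplace transform is
injective.
-/

namespace KleinGordon

open MeasureTheory Topology Real Pointwise
open scoped ContDiff Interval FourierTransform Distributions LineDeriv

section WeakDerivative

variable {E : Type*} [NormedAddCommGroup E] [NormedSpace ℝ E] {U : Set ℝ}

/-- `k` is the weak derivative of `g` on `U`, tested against real smooth functions with compact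
support in `U`. -/
def HasWeakDerivOn (g k : ℝ → E) (U : Set ℝ) : Prop :=
  ∀ A : ℝ → ℝ, ContDiff ℝ ∞ A → HasCompactSupport A → tsupport A ⊆ U →
    ∫ x, deriv A x • g x = -∫ x, A x • k x

theorem HasWeakDerivOn.sub {g₁ g₂ k₁ k₂ : ℝ → E} (h₁ : HasWeakDerivOn g₁ k₁ U)
    (h₂ : HasWeakDerivOn g₂ k₂ U) (hg₁ : Continuous g₁) (hg₂ : Continuous g₂)
    (hk₁ : Continuous k₁) (hk₂ : Continuous k₂) :
    HasWeakDerivOn (g₁ - g₂) (k₁ - k₂) U := by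
  intro A hA hAc hAU
  have hA' : Continuous (deriv A) := hA.continuous_deriv (by simp)
  have integrable_deriv {g : ℝ → E} (hg : Continuous g) : Integrable fun x ↦ deriv A x • g x :=
    (hA'.smul hg).integrable_of_hasCompactSupport hAc.deriv.smul_right
  have integrable {k : ℝ → E} (hk : Continuous k) : Integrable fun x ↦ A x • k x :=
    (hA.continuous.smul hk).integrable_of_hasCompactSupport hAc.smul_right
  simp only [Pi.sub_apply, smul_sub]
  rw [integral_sub (integrable_deriv hg₁) (integrable_deriv hg₂),
    integral_sub (integrable hk₁) (integrable hk₂), h₁ A hA hAc hAU, h₂ A hA hAc hAU]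
  abel

theorem hasWeakDerivOn_of_hasDerivAt {g k : ℝ → E} (hg : ∀ x, HasDerivAt g (k x) x)
    (hk : Continuous k) (U : Set ℝ) : HasWeakDerivOn g k U := by
  intro A hA hAc _
  have hgc : Continuous g := continuous_iff_continuousAt.2 fun x ↦ (hg x).continuousAt
  have hA' : Continuous (deriv A) := hA.continuous_deriv (by simp)
  rw [eq_comm, neg_eq_iff_eq_neg]
  exact integral_bilinear_hasDerivAt_right_eq_neg_left_of_integrable
    (L := ContinuousLinearMap.lsmul ℝ ℝ)
    (fun x _ ↦ (hA.differentiable (by simp) x).hasDerivAt) (fun x _ ↦ hg x)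
    ((hA.continuous.smul hk).integrable_of_hasCompactSupport hAc.smul_right)
    ((hA'.smul hgc).integrable_of_hasCompactSupport hAc.deriv.smul_right)
    ((hA.continuous.smul hgc).integrable_of_hasCompactSupport hAc.smul_right)

theorem exists_testFunction_deriv_eq_translate_sub [U.OrdConnected] {ψ : ℝ → ℝ}
    (hψ : ContDiff ℝ ∞ ψ) (hψc : HasCompactSupport ψ) {d : ℝ}
    (hψU : tsupport ψ ⊆ U ∩ (· - d) ⁻¹' U) :
    ∃ A : ℝ → ℝ, ContDiff ℝ ∞ A ∧ HasCompactSupport A ∧ tsupport A ⊆ U ∧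
      ∀ x, deriv A x = ψ (x + d) - ψ x := by
  let G : ℝ → ℝ := fun x ↦ ∫ s in (0 : ℝ)..x, ψ s
  have hG (x : ℝ) : HasDerivAt G (ψ x) x :=
    (hψ.continuous.integral_hasStrictDerivAt 0 x).hasDerivAt
  let A : ℝ → ℝ := fun x ↦ G (x + d) - G x
  have hA (x : ℝ) : HasDerivAt A (ψ (x + d) - ψ x) x :=
    ((hG (x + d)).comp_add_const x d).sub (hG x)
  have hAψ (x : ℝ) : A x = ∫ s in x..x + d, ψ s :=
    intervalIntegral.integral_interval_sub_left (hψ.continuous.intervalIntegrable _ _)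
      (hψ.continuous.intervalIntegrable _ _)
  let K : Set ℝ := tsupport ψ + [[-d, 0]]
  have hK : IsCompact K := IsCompact.add hψc isCompact_uIcc
  have hKU : K ⊆ U := by
    rintro _ ⟨t, ht, r, hr, rfl⟩
    refine ‹U.OrdConnected›.uIcc_subset (hψU ht).2 (hψU ht).1 ?_
    simpa [sub_eq_add_neg] using (image_const_add_uIcc t (-d) 0).subset ⟨r, hr, rfl⟩
  have hAK : ∀ x ∉ K, A x = 0 := by
    intro x hx
    rw [hAψ]
    refine intervalIntegral.integral_zero_ae (Eventually.of_forall fun s hs ↦ ?_)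
    refine image_eq_zero_of_notMem_tsupport fun hsψ ↦ hx ⟨s, hsψ, x - s, ?_, by simp⟩
    simpa [uIcc_comm] using (image_const_sub_uIcc x x (x + d)).subset ⟨s, uIoc_subset_uIcc hs, rfl⟩
  refine ⟨A, contDiff_infty_iff_deriv.2 ⟨fun x ↦ (hA x).differentiableAt, ?_⟩,
    .intro hK hAK, (closure_minimal (Function.support_subset_iff'.2 hAK) hK.isClosed).trans hKU,
    fun x ↦ (hA x).deriv⟩
  rw [funext fun x ↦ (hA x).deriv]
  fun_prop

variable [CompleteSpace E] [U.OrdConnected]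

theorem HasWeakDerivOn.eq_of_zero (hU : IsOpen U) {h : ℝ → E} (hh : Continuous h)
    (h₀ : HasWeakDerivOn h 0 U) {a b : ℝ} (ha : a ∈ U) (hb : b ∈ U) : h a = h b := by
  set d := b - a with hd
  have hUd : IsOpen (U ∩ (· - d) ⁻¹' U) := hU.inter (hU.preimage (by fun_prop))
  have orthogonal : ∀ ψ : ℝ → ℝ, ContDiff ℝ ∞ ψ → HasCompactSupport ψ →
      tsupport ψ ⊆ U ∩ (· - d) ⁻¹' U → ∫ x, ψ x • (h (x - d) - h x) = 0 := by
    intro ψ hψ hψc hψU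
    obtain ⟨A, hA, hAc, hAU, hAψ⟩ := exists_testFunction_deriv_eq_translate_sub hψ hψc hψU
    have hψi {g : ℝ → E} (hg : Continuous g) : Integrable fun x ↦ ψ x • g x :=
      (hψ.continuous.smul hg).integrable_of_hasCompactSupport hψc.smul_right
    have hψd : ∫ x, ψ (x + d) • h x = ∫ x, ψ x • h (x - d) := by
      simpa using integral_add_right_eq_self (fun x ↦ ψ x • h (x - d)) d
    have hψdi : Integrable fun x ↦ ψ (x + d) • h x := by
      simpa using (hψi (g := fun x ↦ h (x - d)) (by fun_prop)).comp_add_right d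
    calc ∫ x, ψ x • (h (x - d) - h x)
        = ∫ x, deriv A x • h x := by
          simp only [hAψ, smul_sub, sub_smul]
          rw [integral_sub (hψi (by fun_prop)) (hψi hh), integral_sub hψdi (hψi hh), hψd]
      _ = 0 := by simpa using h₀ A hA hAc hAU
  have hcont : Continuous fun x ↦ h (x - d) - h x := by fun_prop
  have hae := hUd.ae_eq_zero_of_integral_contDiff_smul_eq_zero
    (hcont.locallyIntegrable.locallyIntegrableOn _) orthogonal
  have heq := Measure.eqOn_open_of_ae_eq ((ae_restrict_iff' hUd.measurableSet).2 hae) hUd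
    hcont.continuousOn continuousOn_const
  simpa [hd, sub_eq_zero] using heq (x := b) ⟨hb, by simpa [hd] using ha⟩

theorem HasWeakDerivOn.sub_eq_integral (hU : IsOpen U) {g k : ℝ → E} (hgk : HasWeakDerivOn g k U)
    (hg : Continuous g) (hk : Continuous k) {a b : ℝ} (ha : a ∈ U) (hb : b ∈ U) :
    g b - g a = ∫ x in a..b, k x := by
  let K : ℝ → E := fun x ↦ ∫ t in a..x, k t
  have hK (x : ℝ) : HasDerivAt K (k x) x := (hk.integral_hasStrictDerivAt a x).hasDerivAt
  have hKc : Continuous K := continuous_iff_continuousAt.2 fun x ↦ (hK x).continuousAt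
  have hgK : HasWeakDerivOn (g - K) 0 U := by
    simpa using hgk.sub (hasWeakDerivOn_of_hasDerivAt hK hk U) hg hKc hk hk
  have := hgK.eq_of_zero hU (hg.sub hKc) ha hb
  simp only [Pi.sub_apply, K, intervalIntegral.integral_same, sub_zero] at this
  rw [this, sub_sub_cancel]

end WeakDerivative

section TensorTestFunction

variable {E : Type*} [NormedAddCommGroup E] [NormedSpace ℝ E] {A B : ℝ → ℝ} {v : ℝ × ℝ → E}

theorem tsupport_mul_fst_snd_subset (A B : ℝ → ℝ) :
    tsupport (fun p : ℝ × ℝ ↦ A p.1 * B p.2) ⊆ tsupport A ×ˢ tsupport B := by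
  refine closure_minimal (fun p hp ↦ ?_) ((isClosed_tsupport A).prod (isClosed_tsupport B))
  exact ⟨subset_tsupport A (left_ne_zero_of_mul hp), subset_tsupport B (right_ne_zero_of_mul hp)⟩

theorem hasCompactSupport_mul_fst_snd (hAc : HasCompactSupport A) (hBc : HasCompactSupport B) :
    HasCompactSupport fun p : ℝ × ℝ ↦ A p.1 * B p.2 :=
  (IsCompact.prod hAc hBc).of_isClosed_subset (isClosed_tsupport _)
    (tsupport_mul_fst_snd_subset A B)

theorem lineDeriv_mul_fst_snd_fst (hA : Differentiable ℝ A) (B : ℝ → ℝ) (p : ℝ × ℝ) :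
    lineDeriv ℝ (fun q : ℝ × ℝ ↦ A q.1 * B q.2) p (1, 0) = deriv A p.1 * B p.2 := by
  have h := ((hA (p.1 + 0)).hasDerivAt.comp_const_add p.1 0).mul_const (B p.2)
  simpa [lineDeriv] using h.deriv

theorem lineDeriv_mul_fst_snd_snd (A : ℝ → ℝ) (hB : Differentiable ℝ B) (p : ℝ × ℝ) :
    lineDeriv ℝ (fun q : ℝ × ℝ ↦ A q.1 * B q.2) p (0, 1) = A p.1 * deriv B p.2 := by
  have h := ((hB (p.2 + 0)).hasDerivAt.comp_const_add p.2 0).const_mul (A p.1)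
  simpa [lineDeriv] using h.deriv

theorem integral_mul_fst_snd_smul (hA : Continuous A) (hAc : HasCompactSupport A)
    (hB : Continuous B) (hBc : HasCompactSupport B) (hv : Continuous v) :
    ∫ p : ℝ × ℝ, (A p.1 * B p.2) • v p = ∫ x, A x • ∫ y, B y • v (x, y) := by
  have hint : Integrable fun p : ℝ × ℝ ↦ (A p.1 * B p.2) • v p :=
    Continuous.integrable_of_hasCompactSupport (by fun_prop)
      (hasCompactSupport_mul_fst_snd hAc hBc).smul_right
  rw [Measure.volume_eq_prod] at hint ⊢
  rw [integral_prod _ hint]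
  simp_rw [← integral_smul, mul_smul]

theorem exists_integral_smul_eq_intervalIntegral (E : Type*) [NormedAddCommGroup E]
    [NormedSpace ℝ E] (hBc : HasCompactSupport B) :
    ∃ c d : ℝ, ∀ f : ℝ → E, ∫ y, B y • f y = ∫ y in c..d, B y • f y := by
  obtain ⟨c, hc⟩ := IsCompact.bddBelow hBc
  obtain ⟨d, hd⟩ := IsCompact.bddAbove hBc
  refine ⟨c - 1, d, fun f ↦ (intervalIntegral.integral_eq_integral_of_support_subset ?_).symm⟩
  intro y hy
  have hyB : y ∈ tsupport B := subset_tsupport B (left_ne_zero_of_smul hy)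
  exact ⟨(sub_one_lt c).trans_le (hc hyB), hd hyB⟩

theorem continuous_integral_smul (hB : Continuous B) (hBc : HasCompactSupport B)
    (hv : Continuous v) : Continuous fun x ↦ ∫ y, B y • v (x, y) := by
  obtain ⟨c, d, hcd⟩ := exists_integral_smul_eq_intervalIntegral E hBc
  simp only [hcd]
  fun_prop

theorem intervalIntegral_integral_smul_comm (hB : Continuous B) (hBc : HasCompactSupport B)
    (hv : Continuous v) (a b : ℝ) :
    ∫ x in a..b, ∫ y, B y • v (x, y) = ∫ y, B y • ∫ x in a..b, v (x, y) := by
  obtain ⟨c, d, hcd⟩ := exists_integral_smul_eq_intervalIntegral E hBc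
  simp only [hcd]
  simp only [← intervalIntegral.integral_smul]
  have hcont : Continuous (Function.uncurry fun x y ↦ B y • v (x, y)) := by fun_prop
  exact intervalIntegral_intervalIntegral_swap <|
    (hcont.continuousOn.integrableOn_compact (isCompact_uIcc.prod isCompact_uIcc)).mono_set
      (Set.prod_mono uIoc_subset_uIcc uIoc_subset_uIcc)

end TensorTestFunction

section WeakForm

variable {Ω : TopologicalSpace.Opens (ℝ × ℝ)} {u v : ℝ × ℝ → ℂ} {A B : ℝ → ℝ} {U V : Set ℝ}

theorem IsDistributionalSolution.integral_lineDeriv_lineDeriv_add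
    (hu : IsDistributionalSolution Ω u) (φ : 𝓓(Ω, ℝ)) :
    (∫ p, lineDeriv ℝ (fun q ↦ lineDeriv ℝ φ q (1, 0)) p (0, 1) • u p) + ∫ p, φ p • u p = 0 := by
  have hφ : toDistribution Ω u (∂_{((0, 1) : ℝ × ℝ)} (∂_{((1, 0) : ℝ × ℝ)} φ)) +
      toDistribution Ω u φ = 0 := by
    refine Eq.trans ?_ congr($(hu.2) φ)
    rw [add_apply, Distribution.lineDerivOp_apply_apply, map_neg,
      Distribution.lineDerivOp_apply_apply, map_neg, neg_neg]
  have happly (m : ℝ × ℝ) (ψ : 𝓓(Ω, ℝ)) (p : ℝ × ℝ) : (∂_{m} ψ) p = lineDeriv ℝ ψ p m := by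
    rw [TestFunction.lineDerivOp_eq_lineDerivCLM ℝ, TestFunction.lineDerivCLM_apply_of_le le_top]
  rw [toDistribution_apply hu.1, toDistribution_apply hu.1] at hφ
  simpa only [happly, funext (happly _ φ)] using hφ

theorem IsDistributionalSolution.integral_deriv_mul_deriv_add
    (hu : IsDistributionalSolution Ω u) (hA : ContDiff ℝ ∞ A) (hB : ContDiff ℝ ∞ B)
    (hAc : HasCompactSupport A) (hBc : HasCompactSupport B)
    (hAB : tsupport A ×ˢ tsupport B ⊆ (Ω : Set (ℝ × ℝ))) :
    (∫ p : ℝ × ℝ, (deriv A p.1 * deriv B p.2) • u p) +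
      ∫ p : ℝ × ℝ, (A p.1 * B p.2) • u p = 0 := by
  let φ : 𝓓(Ω, ℝ) :=
    { toFun := fun p ↦ A p.1 * B p.2
      contDiff' := (hA.comp contDiff_fst).mul (hB.comp contDiff_snd)
      hasCompactSupport' := hasCompactSupport_mul_fst_snd hAc hBc
      tsupport_subset' := (tsupport_mul_fst_snd_subset A B).trans hAB }
  have hφ : ⇑φ = fun p ↦ A p.1 * B p.2 := rfl
  have h := hu.integral_lineDeriv_lineDeriv_add φ
  simpa only [hφ, lineDeriv_mul_fst_snd_fst (hA.differentiable (by simp)),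
    lineDeriv_mul_fst_snd_snd _ (hB.differentiable (by simp))] using h

theorem integral_mul_fst_snd_smul_congr (huv : EqOn u v Ω)
    (hAB : tsupport A ×ˢ tsupport B ⊆ (Ω : Set (ℝ × ℝ))) :
    ∫ p : ℝ × ℝ, (A p.1 * B p.2) • u p = ∫ p : ℝ × ℝ, (A p.1 * B p.2) • v p := by
  refine integral_congr_ae (Eventually.of_forall fun p ↦ ?_)
  by_cases hp : p ∈ tsupport (fun p : ℝ × ℝ ↦ A p.1 * B p.2)
  · simp only [huv (hAB (tsupport_mul_fst_snd_subset A B hp))]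
  · simp only [image_eq_zero_of_notMem_tsupport hp, zero_smul]

theorem IsDistributionalSolution.hasWeakDerivOn_integral_deriv_smul
    (hu : IsDistributionalSolution Ω u) (hΩ : (Ω : Set (ℝ × ℝ)) = U ×ˢ V) (hv : Continuous v)
    (huv : EqOn u v Ω) (hB : ContDiff ℝ ∞ B) (hBc : HasCompactSupport B) (hBV : tsupport B ⊆ V) :
    HasWeakDerivOn (fun x ↦ ∫ y, deriv B y • v (x, y)) (fun x ↦ ∫ y, B y • v (x, y)) U := by
  intro A hA hAc hAU
  have hAB : tsupport A ×ˢ tsupport B ⊆ (Ω : Set (ℝ × ℝ)) := hΩ ▸ Set.prod_mono hAU hBV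
  have hAB' : tsupport (deriv A) ×ˢ tsupport (deriv B) ⊆ (Ω : Set (ℝ × ℝ)) :=
    (Set.prod_mono tsupport_deriv_subset tsupport_deriv_subset).trans hAB
  rw [← integral_mul_fst_snd_smul (hA.continuous_deriv (by simp)) hAc.deriv
      (hB.continuous_deriv (by simp)) hBc.deriv hv,
    ← integral_mul_fst_snd_smul hA.continuous hAc hB.continuous hBc hv,
    ← integral_mul_fst_snd_smul_congr huv hAB, ← integral_mul_fst_snd_smul_congr huv hAB']
  exact eq_neg_of_add_eq_zero_left (hu.integral_deriv_mul_deriv_add hA hB hAc hBc hAB)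

theorem IsDistributionalSolution.rectangle_eq [U.OrdConnected] [V.OrdConnected]
    (hu : IsDistributionalSolution Ω u) (hΩ : (Ω : Set (ℝ × ℝ)) = U ×ˢ V) (hU : IsOpen U)
    (hV : IsOpen V) (hv : Continuous v) (huv : EqOn u v Ω) {a b c d : ℝ} (ha : a ∈ U) (hb : b ∈ U)
    (hc : c ∈ V) (hd : d ∈ V) :
    (v (b, d) - v (a, d)) - (v (b, c) - v (a, c)) = -∫ y in c..d, ∫ x in a..b, v (x, y) := by
  rw [← intervalIntegral.integral_neg]
  refine HasWeakDerivOn.sub_eq_integral (g := fun y ↦ v (b, y) - v (a, y)) hV ?_ (by fun_prop)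
    (by fun_prop) hc hd
  intro B hB hBc hBV
  have hB' : Continuous (deriv B) := hB.continuous_deriv (by simp)
  have hint (x : ℝ) : Integrable fun y ↦ deriv B y • v (x, y) :=
    Continuous.integrable_of_hasCompactSupport (by fun_prop) hBc.deriv.smul_right
  calc ∫ y, deriv B y • (v (b, y) - v (a, y))
      = (∫ y, deriv B y • v (b, y)) - ∫ y, deriv B y • v (a, y) := by
        simp only [smul_sub, integral_sub (hint b) (hint a)]
    _ = ∫ x in a..b, ∫ y, B y • v (x, y) :=
        (hu.hasWeakDerivOn_integral_deriv_smul hΩ hv huv hB hBc hBV).sub_eq_integral hU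
          (continuous_integral_smul hB' hBc.deriv hv)
          (continuous_integral_smul hB.continuous hBc hv) ha hb
    _ = -∫ y, B y • -∫ x in a..b, v (x, y) := by
        rw [intervalIntegral_integral_smul_comm hB.continuous hBc hv]
        simp only [smul_neg, integral_neg, neg_neg]

end WeakForm

/-- The equation `∂ₓ∂ᵧv + v = 0` on the quarter-plane `x ≥ 0`, `y < 0` with `∂ᵧv(0, ·) = 0`, in
integrated form. -/
def IsMildSolution {E : Type*} [NormedAddCommGroup E] [NormedSpace ℝ E] (v : ℝ × ℝ → E) : Prop :=
  ∀ ⦃x y z : ℝ⦄, 0 ≤ x → y < 0 → z < 0 →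
    v (x, z) = v (x, y) - ∫ η in y..z, ∫ ξ in (0 : ℝ)..x, v (ξ, η)

theorem IsDistributionalSolution.isMildSolution {u v : ℝ × ℝ → ℂ}
    (hu : IsDistributionalSolution openQuarterPlane u) (hv : Continuous v)
    (huv : EqOn u v openQuarterPlane) (hv₀ : ∀ y < 0, v (0, y) = 0) : IsMildSolution v := by
  intro x y z hx hy hz
  rcases hx.eq_or_lt with rfl | hx
  · simp [hv₀ y hy, hv₀ z hz]
  have hrect : ∀ᶠ a in 𝓝[>] 0, (v (x, z) - v (a, z)) - (v (x, y) - v (a, y)) =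
      -∫ η in y..z, ∫ ξ in a..x, v (ξ, η) := by
    filter_upwards [self_mem_nhdsWithin] with a ha
    exact hu.rectangle_eq rfl isOpen_Ioi isOpen_Iio hv huv ha hx hy hz
  have hcont : Continuous fun a ↦ -∫ η in y..z, ∫ ξ in a..x, v (ξ, η) := by
    simp only [intervalIntegral.integral_symm x]
    fun_prop
  have hlim := tendsto_nhds_unique_of_eventuallyEq
    (Continuous.tendsto (by fun_prop) _ |>.mono_left nhdsWithin_le_nhds)
    (hcont.tendsto 0 |>.mono_left nhdsWithin_le_nhds) hrect
  simp only [hv₀ y hy, hv₀ z hz, sub_zero] at hlim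
  rw [sub_eq_add_neg, ← hlim, add_sub_cancel]

section Growth

theorem intervalIntegral_le_of_le_exp {f : ℝ → ℝ} {M θ x : ℝ}
    (hf : IntervalIntegrable f volume 0 x) (hM : 0 ≤ M) (hθ : 0 < θ) (hx : 0 ≤ x)
    (hfM : ∀ ξ ∈ Icc 0 x, f ξ ≤ M * exp (θ * ξ)) :
    ∫ ξ in 0..x, f ξ ≤ M / θ * exp (θ * x) := by
  calc ∫ ξ in 0..x, f ξ
      ≤ ∫ ξ in 0..x, M * exp (θ * ξ) :=
        intervalIntegral.integral_mono_on hx hf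
          (Continuous.intervalIntegrable (by fun_prop) _ _) hfM
    _ = M / θ * (exp (θ * x) - 1) := by
        rw [intervalIntegral.integral_const_mul, intervalIntegral.integral_comp_mul_left _ hθ.ne',
          integral_exp]
        simp [div_eq_mul_inv, mul_assoc]
    _ ≤ M / θ * exp (θ * x) := by gcongr; simp

theorem intervalIntegral_intervalIntegral_le_of_le_exp {m : ℝ × ℝ → ℝ} (hm : Continuous m)
    {M θ κ a b : ℝ} (hM : 0 ≤ M) (hθ : 0 < θ) (hκ : 0 < κ) (ha : 0 ≤ a) (hb : 0 ≤ b)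
    (hmM : ∀ ξ ∈ Icc 0 a, ∀ τ ∈ Icc 0 b, m (ξ, τ) ≤ M * (exp (κ * τ) * exp (θ * ξ))) :
    ∫ τ in 0..b, ∫ ξ in 0..a, m (ξ, τ) ≤ M / (θ * κ) * (exp (κ * b) * exp (θ * a)) := by
  have hinner : ∀ τ ∈ Icc 0 b, ∫ ξ in 0..a, m (ξ, τ) ≤ M / θ * exp (θ * a) * exp (κ * τ) := by
    intro τ hτ
    refine (intervalIntegral_le_of_le_exp (Continuous.intervalIntegrable (by fun_prop) _ _)
      (M := M * exp (κ * τ)) (by positivity) hθ ha fun ξ hξ ↦ ?_).trans_eq (by ring)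
    simpa only [mul_assoc] using hmM ξ hξ τ hτ
  refine (intervalIntegral_le_of_le_exp (Continuous.intervalIntegrable (by fun_prop) _ _)
    (by positivity) hκ hb hinner).trans_eq ?_
  rw [← div_div]
  ring

theorem le_exp_of_le_integral_integral {m : ℝ × ℝ → ℝ} (hm : Continuous m) (hm₀ : ∀ p, 0 ≤ m p)
    {C θ x t : ℝ} (hθ : 0 < θ) (hx : 0 ≤ x) (ht : 0 ≤ t)
    (hle : ∀ ξ ∈ Icc 0 x, ∀ τ ∈ Icc 0 t,
      m (ξ, τ) ≤ C * exp (θ * ξ) + ∫ η in 0..τ, ∫ ζ in 0..ξ, m (ζ, η)) :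
    m (x, t) ≤ 2 * C * exp (2 / θ * t) * exp (θ * x) := by
  have hκ : 0 < 2 / θ := by positivity
  have hC : 0 ≤ C := by simpa using (hm₀ _).trans (hle 0 ⟨le_rfl, hx⟩ 0 ⟨le_rfl, ht⟩)
  -- Relative to this weight the double integral halves the supremum of `m`.
  let W : ℝ × ℝ → ℝ := fun p ↦ exp (2 / θ * p.2) * exp (θ * p.1)
  have hW (p : ℝ × ℝ) : 0 < W p := by positivity
  obtain ⟨⟨a, b⟩, ⟨ha, hb⟩, hmax⟩ :=
    ((isCompact_Icc (a := 0) (b := x)).prod (isCompact_Icc (a := 0) (b := t))).exists_isMaxOn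
      ⟨(x, t), ⟨hx, le_rfl⟩, ⟨ht, le_rfl⟩⟩ (f := fun p ↦ m p / W p)
      (hm.div (by fun_prop) fun p ↦ (hW p).ne').continuousOn
  set M := m (a, b) / W (a, b)
  have hM₀ : 0 ≤ M := div_nonneg (hm₀ _) (hW _).le
  have hmM : ∀ ξ ∈ Icc 0 x, ∀ τ ∈ Icc 0 t, m (ξ, τ) ≤ M * W (ξ, τ) := fun ξ hξ τ hτ ↦
    (div_le_iff₀ (hW _)).1 (hmax (a := (ξ, τ)) ⟨hξ, hτ⟩)
  have hint : ∫ τ in 0..b, ∫ ξ in 0..a, m (ξ, τ) ≤ M / 2 * W (a, b) :=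
    (intervalIntegral_intervalIntegral_le_of_le_exp hm hM₀ hθ hκ ha.1 hb.1 fun ξ hξ τ hτ ↦
      hmM ξ (Icc_subset_Icc_right ha.2 hξ) τ (Icc_subset_Icc_right hb.2 hτ)).trans_eq <| by
        rw [mul_div_cancel₀ _ hθ.ne']
  have hMC : M * W (a, b) ≤ (C + M / 2) * W (a, b) := calc
    M * W (a, b) = m (a, b) := div_mul_cancel₀ _ (hW _).ne'
    _ ≤ C * exp (θ * a) + M / 2 * W (a, b) := (hle a ha b hb).trans (by gcongr)
    _ ≤ C * W (a, b) + M / 2 * W (a, b) := by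
      gcongr
      exact le_mul_of_one_le_left (exp_pos _).le (one_le_exp (mul_nonneg hκ.le hb.1))
    _ = (C + M / 2) * W (a, b) := by ring
  have hM₂ : M ≤ 2 * C := by linarith [le_of_mul_le_mul_right hMC (hW _)]
  calc m (x, t) ≤ M * W (x, t) := hmM x ⟨hx, le_rfl⟩ t ⟨ht, le_rfl⟩
    _ ≤ 2 * C * W (x, t) := by gcongr
    _ = 2 * C * exp (2 / θ * t) * exp (θ * x) := by simp only [W]; ring

variable {E : Type*} [NormedAddCommGroup E] [NormedSpace ℝ E] {v : ℝ × ℝ → E}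

theorem IsMildSolution.norm_le_add_integral (hmild : IsMildSolution v) (hv : Continuous v)
    {σ : ℝ} (hσ : |σ| = 1) {x y t : ℝ} (hx : 0 ≤ x) (ht : 0 ≤ t) (hy : y < 0)
    (hyt : y + σ * t < 0) :
    ‖v (x, y + σ * t)‖ ≤
      ‖v (x, y)‖ + ∫ τ in 0..t, ∫ ξ in 0..x, ‖v (ξ, y + σ * τ)‖ := by
  have hsubst : ∫ η in y..y + σ * t, ∫ ξ in 0..x, v (ξ, η) =
      σ • ∫ τ in 0..t, ∫ ξ in 0..x, v (ξ, y + σ * τ) := by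
    simp [intervalIntegral.smul_integral_comp_add_mul (fun η ↦ ∫ ξ in 0..x, v (ξ, η))]
  rw [hmild hx hy hyt, hsubst]
  refine (norm_sub_le _ _).trans (add_le_add_right ?_ _)
  rw [norm_smul, norm_eq_abs, hσ, one_mul]
  exact (intervalIntegral.norm_integral_le_integral_norm ht).trans <|
    intervalIntegral.integral_mono_on ht (Continuous.intervalIntegrable (by fun_prop) _ _)
      (Continuous.intervalIntegrable (by fun_prop) _ _)
      fun τ _ ↦ intervalIntegral.norm_integral_le_integral_norm hx

theorem IsMildSolution.norm_le (hmild : IsMildSolution v) (hv : Continuous v) {C θ y₀ : ℝ}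
    (hθ : 0 < θ) (hy₀ : y₀ < 0) (hC : ∀ x, 0 ≤ x → ‖v (x, y₀)‖ ≤ C * exp (θ * x)) {x y : ℝ}
    (hx : 0 ≤ x) (hy : y < 0) :
    ‖v (x, y)‖ ≤ 2 * C * exp (2 / θ * |y - y₀|) * exp (θ * x) := by
  obtain ⟨σ, hσ, hσy⟩ : ∃ σ : ℝ, |σ| = 1 ∧ y₀ + σ * |y - y₀| = y := by
    rcases le_total y₀ y with h | h
    · exact ⟨1, by simp, by rw [abs_of_nonneg (sub_nonneg.2 h)]; ring⟩
    · exact ⟨-1, by simp, by rw [abs_of_nonpos (sub_nonpos.2 h)]; ring⟩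
  have hneg : ∀ τ ∈ Icc 0 |y - y₀|, y₀ + σ * τ < 0 := by
    intro τ hτ
    rcases eq_or_eq_neg_of_abs_eq hσ with rfl | rfl <;> linarith [hτ.1, hτ.2]
  have h := le_exp_of_le_integral_integral (m := fun p ↦ ‖v (p.1, y₀ + σ * p.2)‖) (by fun_prop)
    (fun _ ↦ norm_nonneg _) hθ hx (abs_nonneg (y - y₀)) fun ξ hξ τ hτ ↦
      (hmild.norm_le_add_integral hv hσ hξ.1 hτ.1 hy₀ (hneg τ hτ)).trans
        (add_le_add_left (hC ξ hξ.1) _)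
  rwa [hσy] at h

theorem IsMildSolution.exists_eventually_norm_le (hmild : IsMildSolution v) (hv : Continuous v)
    {C θ y₀ : ℝ} (hθ : 0 < θ) (hy₀ : y₀ < 0)
    (hC : ∀ x, 0 ≤ x → ‖v (x, y₀)‖ ≤ C * exp (θ * x)) {y : ℝ} (hy : y < 0) :
    ∃ M, ∀ᶠ η in 𝓝 y, ∀ x, 0 ≤ x → ‖v (x, η)‖ ≤ M * exp (θ * x) := by
  have hC₀ : 0 ≤ C := by simpa using (norm_nonneg _).trans (hC 0 le_rfl)
  have hdist : ∀ᶠ η in 𝓝 y, |η - y₀| < |y - y₀| + 1 :=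
    (continuous_id.sub continuous_const).abs.continuousAt.eventually_lt_const (lt_add_one _)
  refine ⟨2 * C * exp (2 / θ * (|y - y₀| + 1)), ?_⟩
  filter_upwards [hdist, Iio_mem_nhds hy] with η hη hη₀ x hx
  refine (hmild.norm_le hv hθ hy₀ hC hx hη₀).trans ?_
  gcongr

end Growth

section LaplaceTransform

variable {E : Type*} [NormedAddCommGroup E] [NormedSpace ℂ E] {f : ℝ → E} {M θ : ℝ} {z : ℂ}

/-- The one-sided Laplace transform `∫₀^∞ e^{-zx} f(x) dx`, equal to `0` where the integral does not
converge absolutely. -/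
noncomputable def laplaceTransform (f : ℝ → E) (z : ℂ) : E :=
  ∫ x in Ioi (0 : ℝ), Complex.exp (-(z * x)) • f x

theorem norm_cexp_neg_mul_smul_le {e : E} {x : ℝ} (he : ‖e‖ ≤ M * exp (θ * x)) (z : ℂ) :
    ‖Complex.exp (-(z * x)) • e‖ ≤ M * exp ((θ - z.re) * x) := by
  have hz : ‖Complex.exp (-(z * x))‖ = exp (-(z.re * x)) := by simp [Complex.norm_exp]
  calc ‖Complex.exp (-(z * x)) • e‖ ≤ exp (-(z.re * x)) * (M * exp (θ * x)) := by
        rw [norm_smul, hz]; gcongr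
    _ = M * exp ((θ - z.re) * x) := by rw [mul_left_comm, ← exp_add]; ring_nf

theorem integrableOn_const_mul_exp (M : ℝ) {a : ℝ} (ha : a < 0) :
    IntegrableOn (fun x ↦ M * exp (a * x)) (Ioi 0) :=
  (integrableOn_exp_mul_Ioi ha 0).const_mul M

theorem ae_norm_cexp_neg_mul_smul_le (hM : ∀ x : ℝ, 0 < x → ‖f x‖ ≤ M * exp (θ * x)) (z : ℂ) :
    ∀ᵐ x : ℝ ∂volume.restrict (Ioi 0),
      ‖Complex.exp (-(z * x)) • f x‖ ≤ M * exp ((θ - z.re) * x) :=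
  (ae_restrict_mem measurableSet_Ioi).mono fun x hx ↦ norm_cexp_neg_mul_smul_le (hM x hx) z

theorem integrableOn_cexp_neg_mul_smul (hf : AEStronglyMeasurable f (volume.restrict (Ioi 0)))
    (hM : ∀ x : ℝ, 0 < x → ‖f x‖ ≤ M * exp (θ * x)) (hz : θ < z.re) :
    IntegrableOn (fun x : ℝ ↦ Complex.exp (-(z * x)) • f x) (Ioi 0) :=
  (integrableOn_const_mul_exp M (sub_neg.2 hz)).mono'
    ((Continuous.aestronglyMeasurable (by fun_prop)).smul hf) (ae_norm_cexp_neg_mul_smul_le hM z)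

theorem norm_laplaceTransform_le (hM : ∀ x : ℝ, 0 < x → ‖f x‖ ≤ M * exp (θ * x)) (hz : θ < z.re) :
    ‖laplaceTransform f z‖ ≤ M / (z.re - θ) := by
  refine (norm_integral_le_of_norm_le (integrableOn_const_mul_exp M (sub_neg.2 hz))
    (ae_norm_cexp_neg_mul_smul_le hM z)).trans_eq ?_
  rw [integral_const_mul, integral_exp_mul_Ioi (sub_neg.2 hz), mul_zero, exp_zero,
    ← neg_sub z.re θ, neg_div_neg_eq, mul_one_div]

theorem laplaceTransform_neg (f : ℝ → E) (z : ℂ) :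
    laplaceTransform (fun x ↦ -f x) z = -laplaceTransform f z := by
  simp only [laplaceTransform, smul_neg, integral_neg]

theorem tendsto_const_mul_exp_neg_mul {a : ℝ} (ha : a < 0) (M : ℝ) :
    Tendsto (fun x ↦ M * exp (a * x)) atTop (𝓝 0) := by
  simpa using (tendsto_exp_atBot.comp (tendsto_id.const_mul_atTop_of_neg ha)).const_mul M

theorem norm_intervalIntegral_le_exp (hf : Continuous f) (hθ : 0 < θ)
    (hM : ∀ x : ℝ, 0 ≤ x → ‖f x‖ ≤ M * exp (θ * x)) {x : ℝ} (hx : 0 ≤ x) :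
    ‖∫ ξ in 0..x, f ξ‖ ≤ M / θ * exp (θ * x) := by
  have hM₀ : 0 ≤ M := by simpa using (norm_nonneg _).trans (hM 0 le_rfl)
  exact (intervalIntegral.norm_integral_le_integral_norm hx).trans <|
    intervalIntegral_le_of_le_exp (hf.norm.intervalIntegrable _ _) hM₀ hθ hx
      fun ξ hξ ↦ hM ξ hξ.1

theorem fourier_indicator_exp_smul (f : ℝ → E) (σ ξ : ℝ) :
    𝓕 ((Ioi 0).indicator fun x : ℝ ↦ Complex.exp (-(σ * x)) • f x) ξ =
      laplaceTransform f (σ + 2 * π * ξ * Complex.I) := by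
  rw [Real.fourier_eq', laplaceTransform, ← integral_indicator measurableSet_Ioi]
  congr 1 with x
  by_cases hx : x ∈ Ioi (0 : ℝ)
  · simp only [indicator_of_mem hx, smul_smul, ← Complex.exp_add, RCLike.inner_apply, conj_trivial]
    congr 2
    push_cast
    ring
  · simp only [indicator_of_notMem hx, smul_zero]

theorem mul_le_exp_of_le_exp {r x δ : ℝ} (hδ : 0 < δ) (hr : 0 ≤ r)
    (hrM : r ≤ M * exp (θ * x)) : x * r ≤ M / δ * exp ((θ + δ) * x) := by
  have hxδ : x ≤ exp (δ * x) / δ := by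
    rw [le_div_iff₀ hδ]
    linarith [add_one_le_exp (δ * x)]
  calc x * r ≤ exp (δ * x) / δ * (M * exp (θ * x)) := by gcongr
    _ = M / δ * exp ((θ + δ) * x) := by rw [add_mul, exp_add]; ring

theorem differentiableAt_laplaceTransform
    (hf : AEStronglyMeasurable f (volume.restrict (Ioi 0)))
    (hM : ∀ x : ℝ, 0 < x → ‖f x‖ ≤ M * exp (θ * x)) (hz : θ < z.re) :
    DifferentiableAt ℂ (laplaceTransform f) z := by
  obtain ⟨δ, hδ, hδz⟩ : ∃ δ > 0, θ + δ < z.re - δ :=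
    ⟨(z.re - θ) / 3, by linarith, by linarith⟩
  have hxM (x : ℝ) (hx : 0 < x) : ‖-(x : ℂ) • f x‖ ≤ M / δ * exp ((θ + δ) * x) := by
    rw [norm_smul, norm_neg, Complex.norm_real, norm_of_nonneg hx.le]
    exact mul_le_exp_of_le_exp hδ (norm_nonneg _) (hM x hx)
  refine (hasDerivAt_integral_of_dominated_loc_of_deriv_le
    (F := fun (w : ℂ) (x : ℝ) ↦ Complex.exp (-(w * x)) • f x)
    (F' := fun (w : ℂ) (x : ℝ) ↦ Complex.exp (-(w * x)) • -(x : ℂ) • f x)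
    (Metric.ball_mem_nhds z hδ)
    (.of_forall fun w ↦ (Continuous.aestronglyMeasurable (by fun_prop)).smul hf)
    (integrableOn_cexp_neg_mul_smul hf hM hz)
    ((Continuous.aestronglyMeasurable (by fun_prop)).smul
      ((Continuous.aestronglyMeasurable (by fun_prop)).smul hf))
    ?_ (integrableOn_const_mul_exp (M / δ) (sub_neg.2 hδz)) ?_).2.differentiableAt
  · filter_upwards [ae_restrict_mem measurableSet_Ioi] with x (hx : 0 < x) w hw
    have hM₀ : 0 ≤ M := nonneg_of_mul_nonneg_left ((norm_nonneg _).trans (hM x hx)) (exp_pos _)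
    have hre : z.re - δ ≤ w.re := by
      have := (Complex.abs_re_le_norm (w - z)).trans (mem_ball_iff_norm.1 hw).le
      linarith [(abs_le.1 this).1, Complex.sub_re w z]
    refine (norm_cexp_neg_mul_smul_le (hxM x hx) w).trans ?_
    gcongr
  · refine .of_forall fun x w _ ↦ ?_
    have hexp : HasDerivAt (fun w : ℂ ↦ Complex.exp (-(w * x)))
        (Complex.exp (-(w * x)) * -(1 * (x : ℂ))) w :=
      ((hasDerivAt_id w).mul_const (x : ℂ)).neg.cexp
    simpa [mul_smul] using hexp.smul_const (f x)

variable [CompleteSpace E]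

theorem laplaceTransform_of_hasDerivAt {F : ℝ → E} (hF : ∀ x, HasDerivAt F (f x) x)
    (hf : AEStronglyMeasurable f (volume.restrict (Ioi 0))) {K : ℝ}
    (hK : ∀ x : ℝ, 0 < x → ‖F x‖ ≤ K * exp (θ * x)) (hM : ∀ x : ℝ, 0 < x → ‖f x‖ ≤ M * exp (θ * x))
    (hz : θ < z.re) :
    laplaceTransform f z = z • laplaceTransform F z - F 0 := by
  have hFc : Continuous F := continuous_iff_continuousAt.2 fun x ↦ (hF x).continuousAt
  have hderiv (x : ℝ) : HasDerivAt (fun x : ℝ ↦ Complex.exp (-(z * x)) • F x)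
      (Complex.exp (-(z * x)) • f x - z • Complex.exp (-(z * x)) • F x) x := by
    have hexp : HasDerivAt (fun x : ℝ ↦ Complex.exp (-(z * x)))
        (Complex.exp (-(z * x)) * -(z * 1)) x :=
      ((Complex.ofRealCLM.hasDerivAt (x := x)).const_mul z).neg.cexp
    refine (hexp.smul (hF x)).congr_deriv ?_
    module
  have hlim : Tendsto (fun x : ℝ ↦ Complex.exp (-(z * x)) • F x) atTop (𝓝 0) := by
    refine squeeze_zero_norm' ?_ (tendsto_const_mul_exp_neg_mul (sub_neg.2 hz) K)
    filter_upwards [eventually_gt_atTop 0] with x hx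
    exact norm_cexp_neg_mul_smul_le (hK x hx) z
  have hfint := integrableOn_cexp_neg_mul_smul hf hM hz
  have hFint : IntegrableOn (fun x : ℝ ↦ z • Complex.exp (-(z * x)) • F x) (Ioi 0) :=
    (integrableOn_cexp_neg_mul_smul hFc.aestronglyMeasurable hK hz).smul z
  have hFTC := integral_Ioi_of_hasDerivAt_of_tendsto (hderiv 0).continuousAt.continuousWithinAt
    (fun x _ ↦ hderiv x) (hfint.sub hFint) hlim
  rw [integral_sub hfint hFint, integral_smul, sub_eq_iff_eq_add'] at hFTC
  simpa [laplaceTransform, sub_eq_add_neg] using hFTC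

theorem laplaceTransform_intervalIntegral (hf : Continuous f) (hθ : 0 < θ)
    (hM : ∀ x : ℝ, 0 ≤ x → ‖f x‖ ≤ M * exp (θ * x)) (hz : θ < z.re) :
    laplaceTransform (fun x ↦ ∫ ξ in 0..x, f ξ) z = z⁻¹ • laplaceTransform f z := by
  have hz₀ : z ≠ 0 := by
    rintro rfl
    exact (hθ.trans hz).false
  have h := laplaceTransform_of_hasDerivAt
    (fun x ↦ (hf.integral_hasStrictDerivAt 0 x).hasDerivAt) hf.aestronglyMeasurable
    (fun x hx ↦ norm_intervalIntegral_le_exp hf hθ hM hx.le) (fun x hx ↦ hM x hx.le) hz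
  rw [h, intervalIntegral.integral_same, sub_zero, inv_smul_smul₀ hz₀]

theorem laplaceTransform_eq_zero_of_eventuallyEq
    (hf : AEStronglyMeasurable f (volume.restrict (Ioi 0)))
    (hM : ∀ x : ℝ, 0 < x → ‖f x‖ ≤ M * exp (θ * x)) {z₀ : ℂ} (hz₀ : θ < z₀.re)
    (hL : laplaceTransform f =ᶠ[𝓝 z₀] 0) (hz : θ < z.re) : laplaceTransform f z = 0 := by
  have hanalytic : AnalyticOnNhd ℂ (laplaceTransform f) {w | θ < w.re} :=
    DifferentiableOn.analyticOnNhd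
      (fun w hw ↦ (differentiableAt_laplaceTransform hf hM hw).differentiableWithinAt)
      (isOpen_lt continuous_const Complex.continuous_re)
  exact hanalytic.eqOn_zero_of_preconnected_of_eventuallyEq_zero
    (convex_halfSpace_re_gt θ).isPreconnected hz₀ hL hz

theorem eq_zero_of_laplaceTransform_eq_zero (hf : ContinuousOn f (Ioi 0))
    (hM : ∀ x : ℝ, 0 < x → ‖f x‖ ≤ M * exp (θ * x)) {σ : ℝ} (hσ : θ < σ)
    (hL : ∀ z : ℂ, z.re = σ → laplaceTransform f z = 0) {x : ℝ} (hx : 0 < x) : f x = 0 := by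
  set p : ℝ → E := (Ioi 0).indicator fun x : ℝ ↦ Complex.exp (-(σ * x)) • f x
  have hp : Integrable p := (integrable_indicator_iff measurableSet_Ioi).2
    (integrableOn_cexp_neg_mul_smul (hf.aestronglyMeasurable measurableSet_Ioi) hM (by simpa))
  have hpx : p =ᶠ[𝓝 x] fun x ↦ Complex.exp (-(σ * x)) • f x := by
    filter_upwards [Ioi_mem_nhds hx] with t ht using indicator_of_mem ht _
  have hpc : ContinuousAt p x := by
    refine ContinuousAt.congr ?_ hpx.symm
    have hfx : ContinuousAt f x := hf.continuousAt (Ioi_mem_nhds hx)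
    fun_prop
  have hFp : 𝓕 p = 0 := by
    ext ξ
    rw [fourier_indicator_exp_smul, Pi.zero_apply, hL _ (by simp)]
  have hinv : 𝓕⁻ (𝓕 p) x = p x :=
    hp.fourierInv_fourier_eq (by rw [hFp]; exact integrable_zero _ _ _) hpc
  have hpx₀ : p x = 0 := by
    rw [← hinv, hFp]
    simp [Real.fourierInv_eq']
  rw [hpx.eq_of_nhds] at hpx₀
  exact (smul_eq_zero_iff_right (Complex.exp_ne_zero _)).1 hpx₀

end LaplaceTransform

section Evolution

variable {E : Type*} [NormedAddCommGroup E] [NormedSpace ℂ E]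

theorem eq_cexp_smul_of_hasDerivAt {h : ℝ → E} {c : ℂ} {U : Set ℝ} (hU : IsOpen U)
    (hUc : IsPreconnected U) (hh : ∀ y ∈ U, HasDerivAt h (-(c • h y)) y) {y y' : ℝ} (hy : y ∈ U)
    (hy' : y' ∈ U) : h y = Complex.exp (c * (y' - y)) • h y' := by
  have hderiv : ∀ t ∈ U, HasDerivAt (fun t : ℝ ↦ Complex.exp (c * t) • h t) 0 t := by
    intro t ht
    have hexp : HasDerivAt (fun t : ℝ ↦ Complex.exp (c * t)) (Complex.exp (c * t) * (c * 1)) t :=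
      ((Complex.ofRealCLM.hasDerivAt (x := t)).const_mul c).cexp
    refine (hexp.smul (hh t ht)).congr_deriv ?_
    module
  have hconst := hU.is_const_of_deriv_eq_zero hUc
    (fun t ht ↦ (hderiv t ht).differentiableAt.differentiableWithinAt)
    (fun t ht ↦ (hderiv t ht).deriv) hy hy'
  rw [mul_sub, Complex.exp_sub, div_eq_inv_mul, mul_smul, ← hconst,
    inv_smul_smul₀ (Complex.exp_ne_zero _)]

variable [CompleteSpace E] {v : ℝ × ℝ → E} {C K θ η y₀ : ℝ} {z : ℂ}

theorem IsMildSolution.hasDerivAt (hmild : IsMildSolution v) (hv : Continuous v) {x y : ℝ}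
    (hx : 0 ≤ x) (hy : y < 0) :
    HasDerivAt (fun η ↦ v (x, η)) (-∫ ξ in 0..x, v (ξ, y)) y := by
  have hcont : Continuous fun η ↦ ∫ ξ in 0..x, v (ξ, η) := by fun_prop
  refine ((hcont.integral_hasStrictDerivAt y y).hasDerivAt.const_sub (v (x, y)))
    |>.congr_of_eventuallyEq ?_
  filter_upwards [Iio_mem_nhds hy] with z hz using hmild hx hy hz

theorem IsMildSolution.hasDerivAt_laplaceTransform (hmild : IsMildSolution v)
    (hv : Continuous v) (hθ : 0 < θ) (hy₀ : y₀ < 0)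
    (hC : ∀ x, 0 ≤ x → ‖v (x, y₀)‖ ≤ C * exp (θ * x)) (hz : θ < z.re) {y : ℝ} (hy : y < 0) :
    HasDerivAt (fun η ↦ laplaceTransform (fun x ↦ v (x, η)) z)
      (-(z⁻¹ • laplaceTransform (fun x ↦ v (x, y)) z)) y := by
  obtain ⟨M, hM⟩ := hmild.exists_eventually_norm_le hv hθ hy₀ hC hy
  have hderiv := (hasDerivAt_integral_of_dominated_loc_of_deriv_le
    (μ := volume.restrict (Ioi 0))
    (F := fun η x ↦ Complex.exp (-(z * x)) • v (x, η))
    (F' := fun η x ↦ Complex.exp (-(z * x)) • -∫ ξ in 0..x, v (ξ, η))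
    (bound := fun x ↦ M / θ * exp ((θ - z.re) * x))
    (inter_mem hM (Iio_mem_nhds hy))
    (.of_forall fun η ↦ Continuous.aestronglyMeasurable (by fun_prop))
    (integrableOn_cexp_neg_mul_smul (Continuous.aestronglyMeasurable (by fun_prop))
      (fun x hx ↦ hM.self_of_nhds x hx.le) hz)
    (Continuous.aestronglyMeasurable (by fun_prop)) ?_
    (integrableOn_const_mul_exp _ (sub_neg.2 hz)) ?_).2
  · rw [← laplaceTransform_intervalIntegral (by fun_prop) hθ hM.self_of_nhds hz,
      ← laplaceTransform_neg]
    exact hderiv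
  · filter_upwards [ae_restrict_mem measurableSet_Ioi] with x hx η hη
    refine norm_cexp_neg_mul_smul_le ?_ z
    rw [norm_neg]
    exact norm_intervalIntegral_le_exp (by fun_prop) hθ hη.1 (le_of_lt hx)
  · filter_upwards [ae_restrict_mem measurableSet_Ioi] with x hx η hη
    exact (hmild.hasDerivAt hv (le_of_lt hx) hη.2).const_smul _

theorem IsMildSolution.laplaceTransform_eq_zero (hmild : IsMildSolution v) (hv : Continuous v)
    (hθ : 0 < θ)
    (hK : ∃ᶠ y in atBot, ∀ x, 0 ≤ x → ‖v (x, y)‖ ≤ K * exp (η * |y|) * exp (θ * x))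
    (hz : θ < z.re) (hη : η < (z⁻¹).re) {y : ℝ} (hy : y < 0) :
    laplaceTransform (fun x ↦ v (x, y)) z = 0 := by
  have hK' := hK.and_eventually (eventually_lt_atBot 0)
  obtain ⟨y₀, hC, hy₀⟩ := hK'.exists
  have hevol {y' : ℝ} (hy' : y' < 0) : laplaceTransform (fun x ↦ v (x, y)) z =
      Complex.exp (z⁻¹ * (y' - y)) • laplaceTransform (fun x ↦ v (x, y')) z :=
    eq_cexp_smul_of_hasDerivAt isOpen_Iio isPreconnected_Iio
      (fun t ht ↦ hmild.hasDerivAt_laplaceTransform hv hθ hy₀ hC hz ht) hy hy'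
  have hbound : ∃ᶠ y' in atBot, ‖laplaceTransform (fun x ↦ v (x, y)) z‖ ≤
      exp (-((z⁻¹).re * y)) * K / (z.re - θ) * exp ((η - (z⁻¹).re) * |y'|) := by
    refine hK'.mono fun y' ⟨hKy', hy'⟩ ↦ ?_
    have hexp : ‖Complex.exp (z⁻¹ * (y' - y))‖ = exp ((z⁻¹).re * (y' - y)) := by
      rw [Complex.norm_exp, ← Complex.ofReal_sub, Complex.re_mul_ofReal]
    calc ‖laplaceTransform (fun x ↦ v (x, y)) z‖
        ≤ exp ((z⁻¹).re * (y' - y)) * (K * exp (η * |y'|) / (z.re - θ)) := by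
          rw [hevol hy', norm_smul, hexp]
          gcongr
          exact norm_laplaceTransform_le (fun x hx ↦ hKy' x hx.le) hz
      _ = exp (-((z⁻¹).re * y)) * K / (z.re - θ) *
          (exp ((z⁻¹).re * y') * exp (η * |y'|)) := by
          rw [mul_sub, sub_eq_neg_add, exp_add]
          ring
      _ = exp (-((z⁻¹).re * y)) * K / (z.re - θ) * exp ((η - (z⁻¹).re) * |y'|) := by
          rw [← exp_add, abs_of_neg hy']
          ring_nf
  exact norm_le_zero_iff.1 <| ge_of_tendsto_of_frequently
    ((tendsto_const_mul_exp_neg_mul (sub_neg.2 hη) _).comp tendsto_abs_atBot_atTop) hbound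

theorem exists_gt_mul_lt {a b c : ℝ} (h : a * b < c) : ∃ a' > a, a' * b < c :=
  ((continuous_mul_const b).continuousAt.eventually_lt_const h).exists_gt

theorem IsMildSolution.eq_zero (hmild : IsMildSolution v) (hv : Continuous v) (hθ : 0 < θ)
    (hK : ∃ᶠ y in atBot, ∀ x, 0 ≤ x → ‖v (x, y)‖ ≤ K * exp (η * |y|) * exp (θ * x))
    (hθη : θ * η < 1) {x y : ℝ} (hx : 0 < x) (hy : y < 0) : v (x, y) = 0 := by
  obtain ⟨σ, hσθ, hσ⟩ := exists_gt_mul_lt hθη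
  have hσ₀ : 0 < σ := hθ.trans hσθ
  obtain ⟨y₀, hC, hy₀⟩ := (hK.and_eventually (eventually_lt_atBot 0)).exists
  obtain ⟨M, hM⟩ := hmild.exists_eventually_norm_le hv hθ hy₀ hC hy
  have hMy (x : ℝ) (hx : 0 < x) : ‖v (x, y)‖ ≤ M * exp (θ * x) := hM.self_of_nhds x hx.le
  have hL : laplaceTransform (fun x ↦ v (x, y)) =ᶠ[𝓝 (σ : ℂ)] 0 := by
    have hinv : Tendsto (fun z : ℂ ↦ (z⁻¹).re) (𝓝 (σ : ℂ)) (𝓝 σ⁻¹) := by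
      rw [← Complex.ofReal_re σ⁻¹, Complex.ofReal_inv]
      exact (Complex.continuous_re.tendsto _).comp
        (tendsto_inv₀ (Complex.ofReal_ne_zero.2 hσ₀.ne'))
    filter_upwards [Complex.continuous_re.continuousAt.eventually_const_lt hσθ,
      hinv.eventually_const_lt ((lt_inv_mul_iff₀ hσ₀).2 hσ |>.trans_eq (mul_one _))] with z hz hηz
    exact hmild.laplaceTransform_eq_zero hv hθ hK hz hηz hy
  have hvy : Continuous fun x ↦ v (x, y) := by fun_prop
  exact eq_zero_of_laplaceTransform_eq_zero hvy.continuousOn hMy hσθ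
    (fun z hz ↦ laplaceTransform_eq_zero_of_eventuallyEq hvy.aestronglyMeasurable hMy
      (by simpa using hσθ) hL (by rwa [hz])) hx

theorem exists_frequently_norm_le_of_isBigO {F : Type*} [SeminormedAddCommGroup F]
    {u : ℝ × ℝ → F} {Y : Set ℝ} {θ₁ θ₂ : ℝ} (hY : ¬ BddBelow Y)
    (hu : u =O[𝓟 (Ici 0 ×ˢ Y)] fun p : ℝ × ℝ ↦ exp (θ₁ * p.1 + θ₂ * |p.2|)) (hθ : θ₁ ≤ θ) :
    ∃ C, ∃ᶠ y in atBot, ∀ x, 0 ≤ x → ‖u (x, y)‖ ≤ C * exp (θ₂ * |y|) * exp (θ * x) := by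
  obtain ⟨C, hC₀, hC⟩ := hu.exists_nonneg
  refine ⟨C, frequently_atBot.2 fun a ↦ ?_⟩
  obtain ⟨y, hyY, hya⟩ := not_bddBelow_iff.1 hY a
  refine ⟨y, hya.le, fun x hx ↦ (isBigOWith_principal.1 hC (x, y) ⟨hx, hyY⟩).trans ?_⟩
  rw [norm_of_nonneg (exp_pos _).le, add_comm, exp_add, ← mul_assoc]
  gcongr

end Evolution

theorem openQuarterPlane_subset_closedQuarterPlane :
    (openQuarterPlane : Set (ℝ × ℝ)) ⊆ closedQuarterPlane :=
  Set.prod_mono Ioi_subset_Ici_self Iio_subset_Iic_self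

theorem closedQuarterPlane_subset_closure_openQuarterPlane :
    closedQuarterPlane ⊆ closure openQuarterPlane := by
  simp [closedQuarterPlane, openQuarterPlane, closure_prod_eq]

end KleinGordon

open KleinGordon Real in
theorem theorem1p9_general (u : ℝ × ℝ → ℂ) (Y : Set ℝ) (θ₁ θ₂ : ℝ)
    (hcont : ContinuousOn u closedQuarterPlane)
    (hsol : IsDistributionalSolution openQuarterPlane u)
    (hvanish : ∀ y : ℝ, y ≤ 0 → u (0, y) = 0) (hYinf : ¬ BddBelow Y)
    (hgrowth : u =O[𝓟 (Ici (0 : ℝ) ×ˢ Y)]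
      fun p : ℝ × ℝ => exp (θ₁ * p.1 + θ₂ * |p.2|))
    (hθ : θ₁ * θ₂ < 1) :
    ∀ x y : ℝ, 0 ≤ x → y ≤ 0 → u (x, y) = 0 := by
  have hopen := openQuarterPlane_subset_closedQuarterPlane
  obtain ⟨v, hv⟩ := ContinuousMap.exists_restrict_eq (isClosed_Ici.prod isClosed_Iic)
    ⟨_, hcont.domRestrict⟩
  have huv : EqOn u v closedQuarterPlane := fun p hp ↦ (congr($hv ⟨p, hp⟩)).symm
  have hmild : IsMildSolution v := hsol.isMildSolution v.continuous (huv.mono hopen)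
    fun y hy ↦ (huv (x := (0, y)) ⟨mem_Ici.2 le_rfl, hy.le⟩).symm.trans (hvanish y hy.le)
  obtain ⟨θ, hθmax, hθθ₂⟩ : ∃ θ > max θ₁ 0, θ * θ₂ < 1 := by
    refine exists_gt_mul_lt ?_
    rcases max_choice θ₁ 0 with h | h <;> simp [h, hθ]
  obtain ⟨hθ₁, hθ₀⟩ := max_lt_iff.1 hθmax
  obtain ⟨C, hC⟩ := exists_frequently_norm_le_of_isBigO hYinf hgrowth hθ₁.le
  have hvC : ∃ᶠ y in atBot, ∀ x, 0 ≤ x →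
      ‖v (x, y)‖ ≤ C * exp (θ₂ * |y|) * exp (θ * x) :=
    (hC.and_eventually (eventually_le_atBot 0)).mono fun y ⟨hCy, hy⟩ x hx ↦
      huv (x := (x, y)) ⟨hx, hy⟩ ▸ hCy x hx
  have hzero : EqOn u 0 openQuarterPlane := fun p hp ↦
    (huv (hopen hp)).trans (hmild.eq_zero v.continuous hθ₀ hvC hθθ₂ hp.1 hp.2)
  exact fun x y hx hy ↦
    hzero.of_subset_closure hcont continuousOn_const hopen
      closedQuarterPlane_subset_closure_openQuarterPlane (x := (x, y)) ⟨hx, hy⟩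

theorem theorem1p9 (u : ℝ × ℝ → ℂ) (Y : Set ℝ) (θ₁ θ₂ : ℝ)
    (hcont : ContinuousOn u KleinGordon.closedQuarterPlane)
    (hsol : KleinGordon.IsDistributionalSolution KleinGordon.openQuarterPlane u)
    (hvanish : ∀ y : ℝ, y ≤ 0 → u (0, y) = 0)
    (hY : Y ⊆ Iic 0) (hY0 : (0 : ℝ) ∈ Y) (hYinf : ¬ BddBelow Y)
    (hθ₁ : 0 < θ₁) (hθ₂ : 0 < θ₂)
    (hgrowth : u =O[𝓟 (Ici (0 : ℝ) ×ˢ Y)]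
      fun p : ℝ × ℝ => Real.exp (θ₁ * p.1 + θ₂ * |p.2|))
    (hθ : θ₁ * θ₂ < 1) :
    ∀ x y : ℝ, 0 ≤ x → y ≤ 0 → u (x, y) = 0 :=
  theorem1p9_general u Y θ₁ θ₂ hcont hsol hvanish hYinf hgrowth hθ
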